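/- Let $n\ge 1$ and let $p_n$ be a polynomial with complex coefficients, of degree exactly $n$, all of whose zeros lie in the closed unit disk $\{z\in\mathbb{C}: |z|\le 1\}$. Let $n^+$, $n^-$ and $n_0$ denote the numbers of zeros of $p_n$, counted with multiplicity, whose imaginary part is positive, negative and zero, respectively (so $n^++n^-+n_0=n$), and let $\|f\|:=\max_{x\in[-1,1]}|f(x)|$. Then \[\|p_n'\|\ \ge\ \max\Big\{\frac14,\ \frac{1}{900}\sqrt{\frac{\max\{n^+,n^-\}+n_0}{2\min\{n^+,n^-\}+1}}\,\Big\}\,\|p_n\|.\] -/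

import Mathlib

open Polynomial

noncomputable section

/-- The restriction of a complex polynomial to the real segment `[-1, 1]`, as an element of the
Banach space `C([-1, 1], ℂ)`. -/
def segmentRestriction (p : ℂ[X]) : C(Set.Icc (-1 : ℝ) 1, ℂ) where
  toFun x := p.eval ((x : ℝ) : ℂ)
  continuous_toFun := by fun_prop

/-- The uniform norm of a complex polynomial on `[-1, 1]`, that is, the norm of its restriction
in `C([-1, 1], ℂ)`. -/
def segmentNorm (p : ℂ[X]) : ℝ := ‖segmentRestriction p‖

/-- The polynomials of degree exactly `n` all of whose zeros lie in the closed unit disk. -/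
def diskPolynomials (n : ℕ) : Set ℂ[X] :=
  {p | p.degree = n ∧ ∀ z : ℂ, p.IsRoot z → ‖z‖ ≤ 1}

/-- The number of zeros, with multiplicity, with positive imaginary part. -/
def numRootsPos (p : ℂ[X]) : ℕ := p.roots.countP (fun z => 0 < z.im)

/-- The number of zeros, with multiplicity, with negative imaginary part. -/
def numRootsNeg (p : ℂ[X]) : ℕ := p.roots.countP (fun z => z.im < 0)

/-- The number of zeros, with multiplicity, with zero imaginary part. -/
def numRootsZero (p : ℂ[X]) : ℕ := p.roots.countP (fun z => z.im = 0)

end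

/-!
The bound with `1 / 4` is Turán's inequality at the end points: a zero `z` of the disk has
`Re (1 / (1 - z)) ≥ 1 / 2`, so `|p' (±1)| ≥ (n / 2) |p (±1)|`, while `|p|` at the end point nearest
to a maximum point is at least `‖p‖ - ‖p'‖`.

For the bound with the square root, put `l = ‖p‖ / (4 ‖p'‖) ≤ 1`. On an interval of length `2 l`
which contains a maximum point of `|p|` one has `|p| ≥ ‖p‖ / 2`. Rescaled to `[-1, 1]`, the
logarithmic derivative `f = ∑ 1 / (t - z)` is then at most `1 / 2` in modulus. Its real part is
paired with the weight `t - t ^ 3`, which is minus the derivative of the bump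
`φ = (1 - t ^ 2) ^ 2 / 4`. For a zero `z = a + b i` at distance at most `R = 2 / l` from the
segment, the pairing is

  `∫ φ (2 b ^ 2 / |t - z| ^ 4 - 1 / |t - z| ^ 2) ≤ 4 A(z) - 4 / (15 R ^ 2)`,

where `A(z) = |∫ b / |t - z| ^ 2|` is the angle which the segment subtends at `z`
(`integral_weight_le`). The integrals `∫ b / |t - z| ^ 2` sum to `∫ Im f`, which is at most `1` in
modulus; each is at most `π` in modulus and has the sign of `b`. Hence the angles sum to at most
`1 + 2 π m`, where `m` counts the zeros on the sparser side of the real axis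
(`sum_abs_le_of_abs_sum_le`). As the total pairing is at least `-1`, this gives
`n l ^ 2 / 15 ≤ 5 + 8 π m` (`card_le_of_norm_sum_le`), that is,
`‖p'‖ ^ 2 ≥ n / (3120 (2 m + 1)) ‖p‖ ^ 2`.
-/

/-! ### The contribution of a single zero -/

/-- The real and imaginary parts of `1 / (t - z)`, `z = a + b i`, are quotients by
`(t - a) ^ 2 + b ^ 2`, so integrability on `[-1, 1]` reduces to positivity of this denominator. -/
lemma intervalIntegrable_div_quadratic {a b : ℝ}
    (hQ : ∀ t ∈ Set.Icc (-1 : ℝ) 1, 0 < (t - a) ^ 2 + b ^ 2) {g : ℝ → ℝ} (hg : Continuous g)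
    (k : ℕ) :
    IntervalIntegrable (fun t => g t / ((t - a) ^ 2 + b ^ 2) ^ k) MeasureTheory.volume (-1) 1 := by
  apply ContinuousOn.intervalIntegrable_of_Icc (by norm_num)
  exact hg.continuousOn.div (by fun_prop) fun t ht => (pow_pos (hQ t ht) k).ne'

lemma integral_poisson_eq_arctan {a b : ℝ} (hb : b ≠ 0) :
    ∫ t in (-1 : ℝ)..1, b / ((t - a) ^ 2 + b ^ 2) =
      Real.arctan ((1 - a) / b) + Real.arctan ((1 + a) / b) := by
  have hQ : ∀ t ∈ Set.Icc (-1 : ℝ) 1, 0 < (t - a) ^ 2 + b ^ 2 := fun t _ => by positivity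
  have hi := intervalIntegrable_div_quadratic hQ (continuous_const (y := b)) 1
  simp only [pow_one] at hi
  rw [intervalIntegral.integral_eq_sub_of_hasDerivAt
    (f := fun t => Real.arctan ((t - a) / b)) _ hi]
  · rw [sub_eq_add_neg, ← Real.arctan_neg]
    congr 2
    ring
  · intro t _
    have h := ((((hasDerivAt_id t).sub_const a).div_const b).arctan)
    refine h.congr_deriv ?_
    have : (t - a) ^ 2 + b ^ 2 ≠ 0 := by positivity
    have : 1 + ((t - a) / b) ^ 2 ≠ 0 := by positivity
    simp only [id_eq]
    field_simp
    ring

lemma abs_integral_poisson_le_pi (a b : ℝ) :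
    |∫ t in (-1 : ℝ)..1, b / ((t - a) ^ 2 + b ^ 2)| ≤ Real.pi := by
  rcases eq_or_ne b 0 with rfl | hb
  · simpa using Real.pi_pos.le
  · rw [integral_poisson_eq_arctan hb, abs_le]
    have h₁ := Real.neg_pi_div_two_lt_arctan ((1 - a) / b)
    have h₂ := Real.neg_pi_div_two_lt_arctan ((1 + a) / b)
    have h₃ := Real.arctan_lt_pi_div_two ((1 - a) / b)
    have h₄ := Real.arctan_lt_pi_div_two ((1 + a) / b)
    constructor <;> linarith

lemma integral_poisson_neg (a b : ℝ) :
    ∫ t in (-1 : ℝ)..1, (-b) / ((t - a) ^ 2 + (-b) ^ 2) =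
      -∫ t in (-1 : ℝ)..1, b / ((t - a) ^ 2 + b ^ 2) := by
  simp only [neg_sq, neg_div, intervalIntegral.integral_neg]

lemma integral_poisson_nonneg {a b : ℝ} (hb : 0 ≤ b) :
    0 ≤ ∫ t in (-1 : ℝ)..1, b / ((t - a) ^ 2 + b ^ 2) :=
  intervalIntegral.integral_nonneg (by norm_num) fun t _ => by positivity

/-- The segment `[-1, 1]` subtends an angle of at least `π / 4` at a point which lies above it at
height at most `1`. -/
lemma pi_div_four_le_integral_poisson {a b : ℝ} (ha : |a| ≤ 1) (hb : 0 < b) (hb1 : b ≤ 1) :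
    Real.pi / 4 ≤ ∫ t in (-1 : ℝ)..1, b / ((t - a) ^ 2 + b ^ 2) := by
  rw [integral_poisson_eq_arctan hb.ne']
  obtain ⟨h₁, h₂⟩ := abs_le.mp ha
  have p₁ : 0 ≤ Real.arctan ((1 - a) / b) :=
    Real.arctan_nonneg.mpr (div_nonneg (by linarith) hb.le)
  have p₂ : 0 ≤ Real.arctan ((1 + a) / b) :=
    Real.arctan_nonneg.mpr (div_nonneg (by linarith) hb.le)
  rcases le_total a 0 with h | h
  · have : Real.arctan 1 ≤ Real.arctan ((1 - a) / b) :=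
      Real.arctan_mono (by rw [le_div_iff₀ hb]; linarith)
    rw [Real.arctan_one] at this
    linarith
  · have : Real.arctan 1 ≤ Real.arctan ((1 + a) / b) :=
      Real.arctan_mono (by rw [le_div_iff₀ hb]; linarith)
    rw [Real.arctan_one] at this
    linarith

/-- Integration by parts against the bump `(1 - t ^ 2) ^ 2 / 4`, whose derivative is
`-(t - t ^ 3)` and which vanishes at `±1`. -/
lemma integral_weight_by_parts {a b : ℝ}
    (hQ : ∀ t ∈ Set.Icc (-1 : ℝ) 1, 0 < (t - a) ^ 2 + b ^ 2) :
    ∫ t in (-1 : ℝ)..1, (t - t ^ 3) * (t - a) / ((t - a) ^ 2 + b ^ 2) =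
      ∫ t in (-1 : ℝ)..1, (1 - t ^ 2) ^ 2 / 4 * (b ^ 2 - (t - a) ^ 2) /
        ((t - a) ^ 2 + b ^ 2) ^ 2 := by
  have hi₁ := intervalIntegrable_div_quadratic hQ
    (g := fun t => (t - t ^ 3) * (t - a)) (by fun_prop) 1
  have hi₂ := intervalIntegrable_div_quadratic hQ
    (g := fun t => (1 - t ^ 2) ^ 2 / 4 * (b ^ 2 - (t - a) ^ 2)) (by fun_prop) 2
  simp only [pow_one] at hi₁
  rw [← sub_eq_zero, ← intervalIntegral.integral_sub hi₁ hi₂,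
    intervalIntegral.integral_eq_sub_of_hasDerivAt
      (f := fun t => -((1 - t ^ 2) ^ 2 / 4 * ((t - a) / ((t - a) ^ 2 + b ^ 2)))) _ (hi₁.sub hi₂)]
  · norm_num
  · intro t ht
    rw [Set.uIcc_of_le (by norm_num)] at ht
    have hpos := hQ t ht
    have d₁ : HasDerivAt (fun t : ℝ => (1 - t ^ 2) ^ 2 / 4) (-(t - t ^ 3)) t := by
      have := ((((hasDerivAt_id t).pow 2).const_sub 1).pow 2).div_const 4
      refine this.congr_deriv ?_
      simp
      ring
    have d₂ : HasDerivAt (fun t : ℝ => t - a) 1 t := (hasDerivAt_id t).sub_const a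
    have d₃ : HasDerivAt (fun t : ℝ => (t - a) ^ 2 + b ^ 2) (2 * (t - a)) t := by
      have := (d₂.pow 2).add_const (b ^ 2)
      refine this.congr_deriv ?_
      simp
    refine (d₁.mul (d₂.div d₃ hpos.ne')).neg.congr_deriv ?_
    simp only [Pi.div_apply]
    field_simp
    ring

lemma integral_bump : ∫ t in (-1 : ℝ)..1, (1 - t ^ 2) ^ 2 / 4 = 4 / 15 := by
  rw [intervalIntegral.integral_eq_sub_of_hasDerivAt
    (f := fun t => (t - 2 * t ^ 3 / 3 + t ^ 5 / 5) / 4)]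
  · norm_num
  · intro t _
    have := (((hasDerivAt_id t).sub ((((hasDerivAt_id t).pow 3).const_mul 2).div_const 3)).add
      (((hasDerivAt_id t).pow 5).div_const 5)).div_const 4
    refine this.congr_deriv ?_
    simp
    ring
  · exact Continuous.intervalIntegrable (by fun_prop) _ _

/-- A zero `a + b i` outside the open square over the segment: by parts, the pairing is the
integral of the bump against `2 b ^ 2 / Q ^ 2 - 1 / Q`, `Q = (t - a) ^ 2 + b ^ 2`, and the bump
absorbs the possible singularity of `b / Q` at the end points. -/
lemma integral_weight_le_of_far {a b R : ℝ} (hb : 0 ≤ b) (hfar : 1 ≤ |a| ∨ 1 ≤ b)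
    (hQ : ∀ t ∈ Set.Icc (-1 : ℝ) 1, 0 < (t - a) ^ 2 + b ^ 2)
    (hR : ∀ t ∈ Set.Icc (-1 : ℝ) 1, (t - a) ^ 2 + b ^ 2 ≤ R ^ 2) :
    ∫ t in (-1 : ℝ)..1, (t - t ^ 3) * (t - a) / ((t - a) ^ 2 + b ^ 2) ≤
      2 * (∫ t in (-1 : ℝ)..1, b / ((t - a) ^ 2 + b ^ 2)) - 4 / 15 / R ^ 2 := by
  have hi := intervalIntegrable_div_quadratic hQ (continuous_const (y := b)) 1
  simp only [pow_one] at hi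
  have hi₂ := intervalIntegrable_div_quadratic hQ
    (g := fun t => (1 - t ^ 2) ^ 2 / 4 * (b ^ 2 - (t - a) ^ 2)) (by fun_prop) 2
  have hi₃ : IntervalIntegrable (fun t : ℝ => (1 - t ^ 2) ^ 2 / 4 / R ^ 2)
      MeasureTheory.volume (-1) 1 := Continuous.intervalIntegrable (by fun_prop) _ _
  rw [integral_weight_by_parts hQ, ← integral_bump, ← intervalIntegral.integral_const_mul,
    ← intervalIntegral.integral_div, ← intervalIntegral.integral_sub (hi.const_mul 2) hi₃]
  refine intervalIntegral.integral_mono_on (by norm_num) hi₂ ((hi.const_mul 2).sub hi₃) ?_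
  intro t ht
  have hpos := hQ t ht
  have hle := hR t ht
  obtain ⟨ht₁, ht₂⟩ := ht
  have ht2 : t ^ 2 ≤ 1 := by nlinarith
  have hφ : 0 ≤ (1 - t ^ 2) ^ 2 / 4 := by positivity
  have key : (1 - t ^ 2) ^ 2 / 4 * b ≤ (t - a) ^ 2 + b ^ 2 := by
    have hφ1 : (1 - t ^ 2) ^ 2 / 4 ≤ 1 := by nlinarith [sq_nonneg t]
    rcases le_or_gt 1 b with h | h
    · nlinarith [sq_nonneg (t - a)]
    · have ha : 1 ≤ |a| := hfar.resolve_right h.not_ge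
      have : (1 - t ^ 2) ^ 2 / 4 ≤ (t - a) ^ 2 := by
        rcases le_abs.mp ha with h' | h'
        · have h3 : (1 - t) ^ 2 ≤ (t - a) ^ 2 := by nlinarith
          have h4 : (1 + t) ^ 2 ≤ 4 := by nlinarith
          nlinarith [mul_le_mul_of_nonneg_left h4 (sq_nonneg (1 - t))]
        · have h3 : (1 + t) ^ 2 ≤ (t - a) ^ 2 := by nlinarith
          have h4 : (1 - t) ^ 2 ≤ 4 := by nlinarith
          nlinarith [mul_le_mul_of_nonneg_left h4 (sq_nonneg (1 + t))]
      nlinarith [sq_nonneg b]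
  set Q := (t - a) ^ 2 + b ^ 2 with hQdef
  set φ := (1 - t ^ 2) ^ 2 / 4 with hφdef
  have e : φ * (b ^ 2 - (t - a) ^ 2) / Q ^ 2 = 2 * (φ * b / Q) * (b / Q) - φ / Q := by
    have : (t - a) ^ 2 = Q - b ^ 2 := by rw [hQdef]; ring
    rw [this]
    field_simp
    ring
  rw [e]
  have h₁ : φ * b / Q ≤ 1 := (div_le_one hpos).mpr key
  have h₂ : 0 ≤ b / Q := div_nonneg hb hpos.le
  have h₃ : φ / R ^ 2 ≤ φ / Q := div_le_div_of_nonneg_left hφ hpos hle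
  nlinarith [mul_le_mul_of_nonneg_right h₁ h₂]

lemma mul_integral_div_quadratic_nonpos {a b : ℝ} (hb : 0 < b) :
    a * ∫ t in (-1 : ℝ)..1, (t - a) / ((t - a) ^ 2 + b ^ 2) ≤ 0 := by
  have hQ : ∀ t ∈ Set.Icc (-1 : ℝ) 1, 0 < (t - a) ^ 2 + b ^ 2 := fun t _ => by positivity
  have hi := intervalIntegrable_div_quadratic hQ (g := fun t => t - a) (by fun_prop) 1
  simp only [pow_one] at hi
  rw [intervalIntegral.integral_eq_sub_of_hasDerivAt
    (f := fun t => Real.log ((t - a) ^ 2 + b ^ 2) / 2) _ hi]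
  · have p₁ : 0 < (1 - a) ^ 2 + b ^ 2 := by positivity
    have p₂ : 0 < (-1 - a) ^ 2 + b ^ 2 := by positivity
    rcases le_total 0 a with h | h
    · have : Real.log ((1 - a) ^ 2 + b ^ 2) ≤ Real.log ((-1 - a) ^ 2 + b ^ 2) :=
        Real.log_le_log p₁ (by nlinarith)
      nlinarith
    · have : Real.log ((-1 - a) ^ 2 + b ^ 2) ≤ Real.log ((1 - a) ^ 2 + b ^ 2) :=
        Real.log_le_log p₂ (by nlinarith)
      nlinarith
  · intro t _
    have hpos : (t - a) ^ 2 + b ^ 2 ≠ 0 := by positivity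
    have d : HasDerivAt (fun t : ℝ => (t - a) ^ 2 + b ^ 2) (2 * (t - a)) t := by
      have := (((hasDerivAt_id t).sub_const a).pow 2).add_const (b ^ 2)
      refine this.congr_deriv ?_
      simp
    refine ((d.log hpos).div_const 2).congr_deriv ?_
    field_simp

/-- A zero `a + b i` over the segment: with `w t = t - t ^ 3`, the difference quotient
`(w t - w a) / (t - a)` is at most `1`, and the remaining multiple of `w a` has the sign of
`a ∫ (t - a) / Q ≤ 0`. -/
lemma integral_weight_le_two {a b : ℝ} (ha : |a| ≤ 1) (hb : 0 < b) :
    ∫ t in (-1 : ℝ)..1, (t - t ^ 3) * (t - a) / ((t - a) ^ 2 + b ^ 2) ≤ 2 := by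
  have hQ : ∀ t ∈ Set.Icc (-1 : ℝ) 1, 0 < (t - a) ^ 2 + b ^ 2 := fun t _ => by positivity
  have hi₁ := intervalIntegrable_div_quadratic hQ
    (g := fun t => (t - t ^ 3) * (t - a)) (by fun_prop) 1
  have hi₂ := intervalIntegrable_div_quadratic hQ (g := fun t => t - a) (by fun_prop) 1
  simp only [pow_one] at hi₁ hi₂
  have hi₃ : IntervalIntegrable (fun _ : ℝ => (1 : ℝ)) MeasureTheory.volume (-1) 1 :=
    Continuous.intervalIntegrable (by fun_prop) _ _
  have hmono : ∫ t in (-1 : ℝ)..1, (t - t ^ 3) * (t - a) / ((t - a) ^ 2 + b ^ 2) ≤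
      ∫ t in (-1 : ℝ)..1, (1 + (a - a ^ 3) * ((t - a) / ((t - a) ^ 2 + b ^ 2))) := by
    refine intervalIntegral.integral_mono_on (by norm_num) hi₁ (hi₃.add (hi₂.const_mul _)) ?_
    intro t ht
    have hpos := hQ t ht
    have e : (t - t ^ 3) * (t - a) / ((t - a) ^ 2 + b ^ 2) =
        (1 - (t ^ 2 + t * a + a ^ 2)) * (t - a) ^ 2 / ((t - a) ^ 2 + b ^ 2) +
        (a - a ^ 3) * ((t - a) / ((t - a) ^ 2 + b ^ 2)) := by
      field_simp
      ring
    rw [e]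
    gcongr
    rw [div_le_one hpos]
    nlinarith [mul_nonneg (by nlinarith [sq_nonneg (t + a), sq_nonneg t, sq_nonneg a] :
      0 ≤ t ^ 2 + t * a + a ^ 2) (sq_nonneg (t - a)), sq_nonneg b]
  have hint : ∫ t in (-1 : ℝ)..1, (1 + (a - a ^ 3) * ((t - a) / ((t - a) ^ 2 + b ^ 2))) =
      2 + (1 - a ^ 2) * (a * ∫ t in (-1 : ℝ)..1, (t - a) / ((t - a) ^ 2 + b ^ 2)) := by
    rw [intervalIntegral.integral_add hi₃ (hi₂.const_mul _),
      intervalIntegral.integral_const_mul]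
    simp
    ring
  have ha2 : 0 ≤ 1 - a ^ 2 := by
    have := (sq_le_one_iff_abs_le_one a).mpr ha
    linarith
  have := mul_nonpos_of_nonneg_of_nonpos ha2 (mul_integral_div_quadratic_nonpos (a := a) hb)
  linarith

/-- The estimate for a single zero `a + b i`. The weight `t - t ^ 3` sees the decrease of
`Re (1 / (t - z))` at the rate `1 / |t - z| ^ 2`, except near a close non-real zero, and the loss
there is controlled by the angle which the segment subtends at the zero. -/
lemma integral_weight_le {a b R : ℝ} (hR1 : 1 ≤ R)
    (hQ : ∀ t ∈ Set.Icc (-1 : ℝ) 1, 0 < (t - a) ^ 2 + b ^ 2)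
    (hR : ∀ t ∈ Set.Icc (-1 : ℝ) 1, (t - a) ^ 2 + b ^ 2 ≤ R ^ 2) :
    ∫ t in (-1 : ℝ)..1, (t - t ^ 3) * (t - a) / ((t - a) ^ 2 + b ^ 2) ≤
      4 * |∫ t in (-1 : ℝ)..1, b / ((t - a) ^ 2 + b ^ 2)| - 4 / 15 / R ^ 2 := by
  wlog hb : 0 ≤ b generalizing b
  · have := this (b := -b) (by simpa using hQ) (by simpa using hR) (by linarith)
    rwa [integral_poisson_neg, abs_neg, neg_sq] at this
  have hA := integral_poisson_nonneg (a := a) hb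
  rw [abs_of_nonneg hA]
  by_cases hfar : 1 ≤ |a| ∨ 1 ≤ b
  · linarith [integral_weight_le_of_far hb hfar hQ hR]
  · push Not at hfar
    have hb0 : 0 < b := by
      rcases hb.lt_or_eq with h | h
      · exact h
      · have := hQ a ⟨(abs_lt.mp hfar.1).1.le, (abs_lt.mp hfar.1).2.le⟩
        simp [← h] at this
    have h₁ := integral_weight_le_two hfar.1.le hb0
    have h₂ := pi_div_four_le_integral_poisson hfar.1.le hb0 hfar.2.le
    have h₃ : 4 / 15 / R ^ 2 ≤ 4 / 15 := div_le_self (by norm_num) (one_le_pow₀ hR1)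
    linarith [Real.pi_gt_three]

/-! ### Sums of simple poles -/

lemma one_div_ofReal_sub_re (t : ℝ) (z : ℂ) :
    (1 / ((t : ℂ) - z)).re = (t - z.re) / ((t - z.re) ^ 2 + z.im ^ 2) := by
  simp [Complex.normSq_apply, sq]

lemma one_div_ofReal_sub_im (t : ℝ) (z : ℂ) :
    (1 / ((t : ℂ) - z)).im = z.im / ((t - z.re) ^ 2 + z.im ^ 2) := by
  simp [Complex.normSq_apply, sq]

lemma norm_ofReal_sub_sq (t : ℝ) (z : ℂ) :
    ‖(t : ℂ) - z‖ ^ 2 = (t - z.re) ^ 2 + z.im ^ 2 := by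
  rw [← Complex.normSq_eq_norm_sq, Complex.normSq_apply]
  simp [sq]

/-- If `∑ T i` is small, then `∑ |T i|` is controlled by the number of terms of either sign
alone. -/
lemma sum_abs_le_of_abs_sum_le {ι : Type*} [Fintype ι] {T b : ι → ℝ} {c M : ℝ}
    (hT : ∀ i, |T i| ≤ M) (hpos : ∀ i, 0 ≤ b i → 0 ≤ T i) (hneg : ∀ i, b i ≤ 0 → T i ≤ 0)
    (hsum : |∑ i, T i| ≤ c) :
    ∑ i, |T i| ≤ c + 2 * M * min ((Finset.univ.filter fun i => 0 < b i).card : ℝ)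
      ((Finset.univ.filter fun i => b i < 0).card : ℝ) := by
  obtain ⟨h₁, h₂⟩ := abs_le.mp hsum
  have hn : ∑ i, |T i| ≤ ∑ i, (T i + 2 * M * if b i < 0 then 1 else 0) := by
    refine Finset.sum_le_sum fun i _ => ?_
    split_ifs with h
    · linarith [hT i, neg_abs_le (T i)]
    · rw [abs_of_nonneg (hpos i (not_lt.mp h))]
      simp
  have hp : ∑ i, |T i| ≤ ∑ i, (-T i + 2 * M * if 0 < b i then 1 else 0) := by
    refine Finset.sum_le_sum fun i _ => ?_
    split_ifs with h
    · linarith [hT i, le_abs_self (T i)]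
    · rw [abs_of_nonpos (hneg i (not_lt.mp h))]
      simp
  rw [Finset.sum_add_distrib, ← Finset.mul_sum, Finset.sum_boole] at hn hp
  rw [Finset.sum_neg_distrib] at hp
  rcases min_choice ((Finset.univ.filter fun i => 0 < b i).card : ℝ)
    ((Finset.univ.filter fun i => b i < 0).card : ℝ) with h | h <;> rw [h] <;> linarith

/-- A sum of simple poles `∑ 1 / (t - z i)` which is bounded by `1 / 2` on `[-1, 1]` and all of
whose poles lie within distance `R` of the segment has few poles, in terms of the number of poles
on the sparser side of the real axis. -/
lemma card_le_of_norm_sum_le {ι : Type*} [Fintype ι] {z : ι → ℂ} {R : ℝ} (hR1 : 1 ≤ R)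
    (hne : ∀ i, ∀ t ∈ Set.Icc (-1 : ℝ) 1, (t : ℂ) ≠ z i)
    (hR : ∀ i, ∀ t ∈ Set.Icc (-1 : ℝ) 1, ‖(t : ℂ) - z i‖ ≤ R)
    (hf : ∀ t ∈ Set.Icc (-1 : ℝ) 1, ‖∑ i, 1 / ((t : ℂ) - z i)‖ ≤ 1 / 2) :
    Fintype.card ι * (4 / 15 / R ^ 2) ≤
      5 + 8 * Real.pi * min ((Finset.univ.filter fun i => 0 < (z i).im).card : ℝ)
        ((Finset.univ.filter fun i => (z i).im < 0).card : ℝ) := by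
  have hQ : ∀ i, ∀ t ∈ Set.Icc (-1 : ℝ) 1, 0 < (t - (z i).re) ^ 2 + (z i).im ^ 2 := by
    intro i t ht
    rw [← norm_ofReal_sub_sq]
    have := norm_pos_iff.mpr (sub_ne_zero.mpr (hne i t ht))
    positivity
  have hQR : ∀ i, ∀ t ∈ Set.Icc (-1 : ℝ) 1, (t - (z i).re) ^ 2 + (z i).im ^ 2 ≤ R ^ 2 := by
    intro i t ht
    rw [← norm_ofReal_sub_sq]
    exact pow_le_pow_left₀ (norm_nonneg _) (hR i t ht) 2
  have hi : ∀ i, IntervalIntegrable (fun t : ℝ => (z i).im / ((t - (z i).re) ^ 2 + (z i).im ^ 2))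
      MeasureTheory.volume (-1) 1 := fun i => by
    simpa using intervalIntegrable_div_quadratic (hQ i) (continuous_const (y := (z i).im)) 1
  have hj : ∀ i, IntervalIntegrable
      (fun t : ℝ => (t - t ^ 3) * (t - (z i).re) / ((t - (z i).re) ^ 2 + (z i).im ^ 2))
      MeasureTheory.volume (-1) 1 := fun i => by
    simpa using intervalIntegrable_div_quadratic (hQ i)
      (g := fun t => (t - t ^ 3) * (t - (z i).re)) (by fun_prop) 1
  set T : ι → ℝ := fun i => ∫ t in (-1 : ℝ)..1, (z i).im / ((t - (z i).re) ^ 2 + (z i).im ^ 2)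
    with hT
  have hTsum : |∑ i, T i| ≤ 1 := by
    rw [hT, ← intervalIntegral.integral_finsetSum fun i _ => hi i]
    have := intervalIntegral.norm_integral_le_of_norm_le_const
      (f := fun t : ℝ => ∑ i, (z i).im / ((t - (z i).re) ^ 2 + (z i).im ^ 2)) (C := 1 / 2)
      (a := -1) (b := 1) (fun t ht => by
        rw [Set.uIoc_of_le (by norm_num)] at ht
        refine le_trans ?_ (hf t ⟨ht.1.le, ht.2⟩)
        simp only [← one_div_ofReal_sub_im]
        rw [← Complex.im_sum]
        exact Complex.abs_im_le_norm _)
    norm_num at this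
    simpa using this
  have hS : -1 ≤ ∑ i, ∫ t in (-1 : ℝ)..1,
      (t - t ^ 3) * (t - (z i).re) / ((t - (z i).re) ^ 2 + (z i).im ^ 2) := by
    rw [← intervalIntegral.integral_finsetSum fun i _ => hj i]
    have := intervalIntegral.norm_integral_le_of_norm_le_const
      (f := fun t : ℝ => ∑ i, (t - t ^ 3) * (t - (z i).re) /
        ((t - (z i).re) ^ 2 + (z i).im ^ 2)) (C := 1 / 2)
      (a := -1) (b := 1) (fun t ht => by
        rw [Set.uIoc_of_le (by norm_num)] at ht
        refine le_trans ?_ (hf t ⟨ht.1.le, ht.2⟩)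
        simp only [mul_div_assoc, ← one_div_ofReal_sub_re]
        rw [← Finset.mul_sum, ← Complex.re_sum, norm_mul]
        have hw : ‖t - t ^ 3‖ ≤ 1 := by
          rw [Real.norm_eq_abs, show t - t ^ 3 = t * (1 - t ^ 2) by ring, abs_mul]
          have : t ^ 2 ≤ 1 := by nlinarith [ht.1, ht.2]
          exact mul_le_one₀ (abs_le.mpr ⟨ht.1.le, ht.2⟩) (abs_nonneg _)
            (abs_le.mpr ⟨by linarith, by nlinarith⟩)
        exact (mul_le_of_le_one_left (norm_nonneg _) hw).trans (Complex.abs_re_le_norm _))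
    norm_num at this
    exact (abs_le.mp (by simpa using this)).1
  have hmain := Finset.sum_le_sum fun i (_ : i ∈ Finset.univ) =>
    integral_weight_le hR1 (hQ i) (hQR i)
  rw [Finset.sum_sub_distrib, ← Finset.mul_sum, Finset.sum_const, nsmul_eq_mul,
    Finset.card_univ] at hmain
  have habs := sum_abs_le_of_abs_sum_le (T := T) (b := fun i => (z i).im) (M := Real.pi)
    (fun i => abs_integral_poisson_le_pi _ _) (fun i h => integral_poisson_nonneg h)
    (fun i h => by
      have := integral_poisson_nonneg (a := (z i).re) (neg_nonneg.mpr h)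
      rw [integral_poisson_neg] at this
      exact neg_nonneg.mp this) hTsum
  linarith

/-! ### The uniform norm on the segment -/

lemma segmentNorm_nonneg (p : ℂ[X]) : 0 ≤ segmentNorm p := norm_nonneg _

lemma norm_eval_le_segmentNorm (p : ℂ[X]) {x : ℝ} (hx : x ∈ Set.Icc (-1 : ℝ) 1) :
    ‖p.eval (x : ℂ)‖ ≤ segmentNorm p :=
  (segmentRestriction p).norm_coe_le_norm ⟨x, hx⟩

lemma exists_norm_eval_eq_segmentNorm (p : ℂ[X]) :
    ∃ x ∈ Set.Icc (-1 : ℝ) 1, ‖p.eval (x : ℂ)‖ = segmentNorm p := by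
  have hc : Continuous fun x : ℝ => ‖p.eval (x : ℂ)‖ := by fun_prop
  obtain ⟨x, hx, hmax⟩ := isCompact_Icc.exists_isMaxOn
    (Set.nonempty_Icc.mpr (by norm_num : (-1 : ℝ) ≤ 1)) hc.continuousOn
  exact ⟨x, hx, le_antisymm (norm_eval_le_segmentNorm p hx)
    ((ContinuousMap.norm_le _ (norm_nonneg _)).mpr fun y => hmax y.2)⟩

lemma norm_eval_sub_le (p : ℂ[X]) {x y : ℝ} (hx : x ∈ Set.Icc (-1 : ℝ) 1)
    (hy : y ∈ Set.Icc (-1 : ℝ) 1) :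
    ‖p.eval (y : ℂ) - p.eval (x : ℂ)‖ ≤ segmentNorm (derivative p) * |y - x| := by
  have h := (convex_Icc (-1 : ℝ) 1).norm_image_sub_le_of_norm_hasDerivWithin_le
    (f := fun t : ℝ => p.eval (t : ℂ)) (f' := fun t : ℝ => (derivative p).eval (t : ℂ))
    (C := segmentNorm (derivative p))
    (fun t _ => ((p.hasDerivAt (t : ℂ)).comp_ofReal).hasDerivWithinAt)
    (fun t ht => norm_eval_le_segmentNorm _ ht) hx hy
  simpa using h

/-! ### Turán's inequality at the end points -/

/-- A disk zero `z` contributes at least `1 / 2` to `Re (e * p'(e) / p(e))` at `e = ±1`. -/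
lemma half_le_re_mul_one_div_sub {e : ℝ} (he : e ^ 2 = 1) {z : ℂ} (hz : ‖z‖ ≤ 1)
    (hne : (e : ℂ) ≠ z) : 1 / 2 ≤ e * (1 / ((e : ℂ) - z)).re := by
  have hpos : 0 < (e - z.re) ^ 2 + z.im ^ 2 := by
    rw [← norm_ofReal_sub_sq]
    have := norm_pos_iff.mpr (sub_ne_zero.mpr hne)
    positivity
  have hz2 : z.re ^ 2 + z.im ^ 2 ≤ 1 := by
    have : ‖z‖ ^ 2 ≤ 1 := pow_le_one₀ (norm_nonneg _) hz
    rw [← Complex.normSq_eq_norm_sq, Complex.normSq_apply] at this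
    linarith
  rw [one_div_ofReal_sub_re, ← mul_div_assoc, div_le_div_iff₀ (by norm_num) hpos]
  nlinarith

/-- Turán's inequality at the end points `±1` of the segment. -/
lemma natDegree_div_two_mul_norm_eval_le {p : ℂ[X]} (hz : ∀ z : ℂ, p.IsRoot z → ‖z‖ ≤ 1)
    {e : ℝ} (he : e ^ 2 = 1) :
    (p.natDegree : ℝ) / 2 * ‖p.eval (e : ℂ)‖ ≤ ‖(derivative p).eval (e : ℂ)‖ := by
  rcases eq_or_ne (p.eval (e : ℂ)) 0 with h0 | h0
  · simp [h0]
  have hp0 : p ≠ 0 := by rintro rfl; simp at h0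
  have hs := IsAlgClosed.splits p
  rw [← le_div_iff₀ (norm_pos_iff.mpr h0), ← norm_div,
    hs.eval_derivative_div_eval_of_ne_zero h0]
  have habs : |e| = 1 := by
    rw [← sq_eq_sq₀ (abs_nonneg e) zero_le_one, sq_abs, he, one_pow]
  have hle : ∀ s : Multiset ℂ, (∀ z ∈ s, 1 / 2 ≤ e * (1 / ((e : ℂ) - z)).re) →
      (s.card : ℝ) / 2 ≤ e * ((s.map fun z => 1 / ((e : ℂ) - z)).sum).re := by
    intro s
    induction s using Multiset.induction_on with
    | empty => simp
    | cons a s ih =>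
      intro h
      have h₁ := h a (Multiset.mem_cons_self a s)
      have h₂ := ih fun z hz => h z (Multiset.mem_cons_of_mem hz)
      rw [Multiset.map_cons, Multiset.sum_cons, Multiset.card_cons, Complex.add_re]
      push_cast
      linarith
  have := hle p.roots fun z hzr => by
    have hr := (mem_roots hp0).mp hzr
    refine half_le_re_mul_one_div_sub he (hz z hr) ?_
    rintro rfl
    exact h0 hr
  rw [← hs.natDegree_eq_card_roots] at this
  refine this.trans ((le_abs_self _).trans ?_)
  rw [abs_mul, habs, one_mul]
  exact Complex.abs_re_le_norm _

lemma segmentNorm_div_four_le {p : ℂ[X]} (hn : 1 ≤ p.natDegree)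
    (hz : ∀ z : ℂ, p.IsRoot z → ‖z‖ ≤ 1) :
    1 / 4 * segmentNorm p ≤ segmentNorm (derivative p) := by
  obtain ⟨x, hx, hxn⟩ := exists_norm_eval_eq_segmentNorm p
  obtain ⟨e, he, heI, hex⟩ : ∃ e : ℝ, e ^ 2 = 1 ∧ e ∈ Set.Icc (-1 : ℝ) 1 ∧ |e - x| ≤ 1 := by
    rcases le_total 0 x with h | h
    · exact ⟨1, by norm_num, by norm_num, abs_le.mpr ⟨by linarith [hx.2], by linarith⟩⟩
    · exact ⟨-1, by norm_num, by norm_num, abs_le.mpr ⟨by linarith, by linarith [hx.1]⟩⟩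
  have h₁ := natDegree_div_two_mul_norm_eval_le hz he
  have h₂ := norm_eval_le_segmentNorm (derivative p) heI
  have h₃ := norm_eval_sub_le p heI hx
  have h₄ := norm_sub_norm_le (p.eval (x : ℂ)) (p.eval (e : ℂ))
  have hM := segmentNorm_nonneg (derivative p)
  have h₅ : segmentNorm (derivative p) * |x - e| ≤ segmentNorm (derivative p) := by
    rw [abs_sub_comm]
    exact mul_le_of_le_one_right hM hex
  have h₆ : 1 / 2 * ‖p.eval (e : ℂ)‖ ≤ (p.natDegree : ℝ) / 2 * ‖p.eval (e : ℂ)‖ := by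
    gcongr
    exact_mod_cast hn
  linarith

/-! ### The logarithmic derivative near a maximum point -/

lemma Multiset.countP_eq_card_filter_univ {α : Type*} (s : Multiset α) [DecidableEq α]
    (q : α → Prop) [DecidablePred q] :
    s.countP q = (Finset.univ.filter fun i : s => q i).card := by
  conv_lhs => rw [← Multiset.map_univ_coe s, Multiset.countP_map]
  rfl

lemma numRootsPos_add_numRootsNeg_add_numRootsZero (p : ℂ[X]) :
    numRootsPos p + numRootsNeg p + numRootsZero p = p.natDegree := by
  rw [(IsAlgClosed.splits p).natDegree_eq_card_roots, numRootsPos, numRootsNeg, numRootsZero]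
  induction p.roots using Multiset.induction_on with
  | empty => simp
  | cons a s ih =>
    simp only [Multiset.countP_cons, Multiset.card_cons]
    rcases lt_trichotomy a.im 0 with h | h | h
    · simp only [h, h.not_gt, h.ne, if_true, if_false]
      omega
    · simp only [h, lt_irrefl, if_true, if_false]
      omega
    · simp only [h, h.not_gt, h.ne', if_true, if_false]
      omega

/-- If `|p| ≥ A` on the subinterval `[c - l, c + l]` and `l ‖p'‖ ≤ A / 2`, the rescaled
logarithmic derivative of `p` is at most `1 / 2`, which bounds the degree. -/
lemma natDegree_mul_sq_le {p : ℂ[X]} (hz : ∀ z : ℂ, p.IsRoot z → ‖z‖ ≤ 1) {c l A : ℝ}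
    (hl : 0 < l) (hl1 : l ≤ 1) (hA : 0 < A)
    (hI : ∀ t ∈ Set.Icc (-1 : ℝ) 1, c + l * t ∈ Set.Icc (-1 : ℝ) 1)
    (hp : ∀ t ∈ Set.Icc (-1 : ℝ) 1, A ≤ ‖p.eval ((c + l * t : ℝ) : ℂ)‖)
    (hp' : l * segmentNorm (derivative p) ≤ A / 2) :
    p.natDegree * (l ^ 2 / 15) ≤
      5 + 8 * Real.pi * min (numRootsPos p : ℝ) (numRootsNeg p : ℝ) := by
  have hlC : (l : ℂ) ≠ 0 := by exact_mod_cast hl.ne'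
  have hp0 : p ≠ 0 := by
    rintro rfl
    have := hp 0 (by norm_num)
    simp at this
    linarith
  have hroot : ∀ i : p.roots, p.IsRoot (i : ℂ) := fun i => (mem_roots hp0).mp (Multiset.coe_mem)
  have hsub : ∀ (i : p.roots) (t : ℝ),
      (t : ℂ) - ((i : ℂ) - c) / l = (((c + l * t : ℝ) : ℂ) - i) / l := by
    intro i t
    push_cast
    field_simp
    ring
  have hne : ∀ (i : p.roots), ∀ t ∈ Set.Icc (-1 : ℝ) 1, ((c + l * t : ℝ) : ℂ) ≠ i := by
    intro i t ht h
    have := hp t ht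
    rw [h, hroot i, norm_zero] at this
    linarith
  have key := card_le_of_norm_sum_le (ι := p.roots) (z := fun i => ((i : ℂ) - c) / l)
    (R := 2 / l) (by rw [le_div_iff₀ hl]; linarith)
    (fun i t ht => by
      rw [← sub_ne_zero, hsub]
      exact div_ne_zero (sub_ne_zero.mpr (hne i t ht)) hlC)
    (fun i t ht => by
      rw [hsub, norm_div, Complex.norm_real, Real.norm_of_nonneg hl.le]
      gcongr
      refine (norm_sub_le _ _).trans ?_
      have h₁ := hz _ (hroot i)
      have h₂ : ‖((c + l * t : ℝ) : ℂ)‖ ≤ 1 := by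
        rw [Complex.norm_real]
        exact abs_le.mpr (hI t ht)
      linarith)
    (fun t ht => by
      simp only [hsub]
      have hpt := hp t ht
      have hpt0 : p.eval ((c + l * t : ℝ) : ℂ) ≠ 0 := norm_pos_iff.mp (hA.trans_le hpt)
      have e : ∑ i : p.roots, 1 / ((((c + l * t : ℝ) : ℂ) - i) / l) =
          l * ((derivative p).eval ((c + l * t : ℝ) : ℂ) / p.eval ((c + l * t : ℝ) : ℂ)) := by
        rw [(IsAlgClosed.splits p).eval_derivative_div_eval_of_ne_zero hpt0,
          ← Multiset.map_univ p.roots (fun w => 1 / (((c + l * t : ℝ) : ℂ) - w)),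
          ← Finset.sum_eq_multiset_sum, Finset.mul_sum]
        refine Finset.sum_congr rfl fun i _ => ?_
        rw [one_div_div, mul_one_div]
      rw [e, norm_mul, norm_div, Complex.norm_real, Real.norm_of_nonneg hl.le, ← mul_div_assoc,
        div_le_iff₀ (hA.trans_le hpt)]
      have := mul_le_mul_of_nonneg_left (norm_eval_le_segmentNorm (derivative p) (hI t ht)) hl.le
      linarith)
  have him : ∀ i : p.roots, (((i : ℂ) - c) / l).im = (i : ℂ).im / l := by
    intro i
    rw [Complex.div_ofReal_im]
    simp
  simp only [him, div_pos_iff_of_pos_right hl, div_neg_iff, hl, hl.not_gt, and_true, and_false,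
    false_or] at key
  rw [← Multiset.countP_eq_card_filter_univ p.roots (fun w => 0 < w.im),
    ← Multiset.countP_eq_card_filter_univ p.roots (fun w => w.im < 0), Multiset.card_coe,
    ← (IsAlgClosed.splits p).natDegree_eq_card_roots] at key
  have e : 4 / 15 / (2 / l) ^ 2 = l ^ 2 / 15 := by
    field_simp
    norm_num
  rwa [e] at key

lemma natDegree_mul_segmentNorm_sq_le {p : ℂ[X]} (hn : 1 ≤ p.natDegree)
    (hz : ∀ z : ℂ, p.IsRoot z → ‖z‖ ≤ 1) :
    p.natDegree * segmentNorm p ^ 2 ≤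
      3120 * (2 * min (numRootsPos p : ℝ) (numRootsNeg p : ℝ) + 1) *
        segmentNorm (derivative p) ^ 2 := by
  set m := min (numRootsPos p : ℝ) (numRootsNeg p : ℝ) with hm
  have hm0 : 0 ≤ m := le_min (Nat.cast_nonneg _) (Nat.cast_nonneg _)
  have h4 := segmentNorm_div_four_le hn hz
  obtain ⟨x, hx, hxn⟩ := exists_norm_eval_eq_segmentNorm p
  have hder := fun y hy => norm_eval_sub_le p (y := y) hx hy
  have hS_nonneg := segmentNorm_nonneg p
  have hdeg := fun c l A => natDegree_mul_sq_le hz (c := c) (l := l) (A := A)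
  rw [← hm] at hdeg
  set S := segmentNorm p with hS
  set M := segmentNorm (derivative p) with hM
  rcases hS_nonneg.eq_or_lt with h0 | hS0
  · rw [← h0]
    simp only [ne_eq, OfNat.ofNat_ne_zero, not_false_eq_true, zero_pow, mul_zero]
    positivity
  have hM0 : 0 < M := by linarith
  -- On an interval of length `2 l` around a maximum point, `|p|` drops by at most half.
  set l := S / (4 * M) with hl
  have hl0 : 0 < l := by positivity
  have hl1 : l ≤ 1 := by rw [hl, div_le_one (by positivity)]; linarith
  have hlM : l * M = S / 4 := by rw [hl]; field_simp
  have hI : ∀ t ∈ Set.Icc (-1 : ℝ) 1, (1 - l) * x + l * t ∈ Set.Icc (-1 : ℝ) 1 :=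
    fun t ht => convex_Icc (-1 : ℝ) 1 hx ht (by linarith) hl0.le (by ring)
  have key := hdeg ((1 - l) * x) l (S / 2) hl0 hl1 (by linarith) hI
    (fun t ht => by
      have h₁ := hder _ (hI t ht)
      have h₂ : |(1 - l) * x + l * t - x| ≤ 2 * l := by
        rw [show (1 - l) * x + l * t - x = l * (t - x) by ring, abs_mul, abs_of_pos hl0]
        have : |t - x| ≤ 2 := abs_le.mpr ⟨by linarith [ht.1, hx.2], by linarith [ht.2, hx.1]⟩
        nlinarith
      have h₃ := mul_le_mul_of_nonneg_left h₂ hM0.le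
      have h₄ := norm_sub_norm_le (p.eval (x : ℂ)) (p.eval (((1 - l) * x + l * t : ℝ) : ℂ))
      rw [norm_sub_rev] at h₄
      linarith)
    (by linarith)
  have hpi : 5 + 8 * Real.pi * m ≤ 13 * (2 * m + 1) := by
    nlinarith [Real.pi_lt_d2]
  have e : p.natDegree * S ^ 2 = 240 * M ^ 2 * (p.natDegree * (l ^ 2 / 15)) := by
    rw [hl]
    field_simp
    ring
  rw [e]
  nlinarith [mul_le_mul_of_nonneg_left (key.trans hpi) (by positivity : 0 ≤ 240 * M ^ 2)]

theorem corollary2 (n : ℕ) (hn : 1 ≤ n) (p : ℂ[X]) (hp : p ∈ diskPolynomials n) :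
    segmentNorm (derivative p) ≥
      max (1 / 4 : ℝ)
        ((1 / 900 : ℝ) * Real.sqrt
          ((max (numRootsPos p : ℝ) (numRootsNeg p : ℝ) + (numRootsZero p : ℝ)) /
            (2 * min (numRootsPos p : ℝ) (numRootsNeg p : ℝ) + 1)))
        * segmentNorm p := by
  obtain ⟨hdeg, hz⟩ := hp
  rw [← natDegree_eq_of_degree_eq_some hdeg] at hn
  have hS := segmentNorm_nonneg p
  rw [ge_iff_le, max_mul_of_nonneg _ _ hS]
  refine max_le (segmentNorm_div_four_le hn hz) ?_
  have hmain := natDegree_mul_segmentNorm_sq_le hn hz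
  have hcount : (numRootsPos p : ℝ) + numRootsNeg p + numRootsZero p = p.natDegree := by
    exact_mod_cast numRootsPos_add_numRootsNeg_add_numRootsZero p
  have hmm := min_add_max (numRootsPos p : ℝ) (numRootsNeg p : ℝ)
  have hm0 : 0 ≤ min (numRootsPos p : ℝ) (numRootsNeg p : ℝ) :=
    le_min (Nat.cast_nonneg _) (Nat.cast_nonneg _)
  have hN0 : 0 ≤ max (numRootsPos p : ℝ) (numRootsNeg p : ℝ) + (numRootsZero p : ℝ) := by
    positivity
  set m := min (numRootsPos p : ℝ) (numRootsNeg p : ℝ)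
  set N := max (numRootsPos p : ℝ) (numRootsNeg p : ℝ) + (numRootsZero p : ℝ) with hN
  have hN' : N ≤ p.natDegree := by linarith
  refine (pow_le_pow_iff_left₀ (by positivity) (segmentNorm_nonneg _) two_ne_zero).mp ?_
  have hd : 0 < 2 * m + 1 := by linarith
  rw [mul_pow, mul_pow, Real.sq_sqrt (div_nonneg hN0 hd.le)]
  have h₁ : N * segmentNorm p ^ 2 ≤ 3120 * (2 * m + 1) * segmentNorm (derivative p) ^ 2 :=
    (mul_le_mul_of_nonneg_right hN' (sq_nonneg _)).trans hmain
  have h₂ : N / (2 * m + 1) * segmentNorm p ^ 2 ≤ 3120 * segmentNorm (derivative p) ^ 2 := by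
    rw [div_mul_eq_mul_div, div_le_iff₀ hd]
    linarith
  nlinarith [sq_nonneg (segmentNorm (derivative p))]
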